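/- Let $p$ be an odd prime, let $n,g\ge 1$ be integers, and let $A=(\mathbf Z/p^n\mathbf Z)^g$, with Pontryagin dual $\hat A=\mathrm{Hom}(A,U(1))$ and $K=A\times\hat A$. For $k=(x,\chi)\in K$ let $W_k$ be the unitary operator $(W_kf)(u)=\chi(u-x)f(u-x)$ on $L^2(A)$, and let $\mathcal W_k=\chi(x/2)W_k$. The Heisenberg group is $G=\{zW_k: z\in U(1),\,k\in K\}$, a subgroup of the unitary group of $L^2(A)$. Let $e((x,\chi),(y,\lambda))=\chi(y)\lambda(x)^{-1}$, and let $\mathrm{Aut}(K,e)$ be the group of automorphisms of $K$ that preserve $e$. A Weil representation of $\mathrm{Aut}(K,e)$ is a family of unitary operators $W(\alpha)$ on $L^2(A)$, $\alpha\in\mathrm{Aut}(K,e)$, such that $W(\alpha)h=\sigma(\alpha)(h)W(\alpha)$ for all $h\in G$, where $\sigma(\alpha)$ is the automorphism of $G$ that fixes the scalars $z\in U(1)$ and maps $\mathcal W_k$ to $\mathcal W_{\alpha(k)}$ for every $k\in K$. Then: 1. Identifying $(x,y)\in A\times A$ with $(x,\chi_y)\in K$, where $\chi_y(u)=e^{2\pi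 i\,y\cdot u/p^n}$, identifies $\mathrm{Aut}(K,e)$ with the symplectic group $Sp_{2g}(\mathbf Z/p^n\mathbf Z)$, acting on $A\times A=(\mathbf Z/p^n\mathbf Z)^{2g}$ by matrix multiplication. 2. A Weil representation $W$ of $\mathrm{Aut}(K,e)$ exists. 3. Every such $W$ is a projective representation, that is, there are $c(\alpha,\beta)\in U(1)$ with $W(\alpha)W(\beta)=c(\alpha,\beta)W(\alpha\beta)$ for all $\alpha,\beta$. It has a multiplicity-free decomposition into $n+1$ irreducible representations: $L^2(A)$ is the direct sum of $n+1$ irreducible invariant subspaces, no two of which are isomorphic. Here an isomorphism of invariant subspaces is a linear isomorphism that commutes with all the operators $W(\alpha)$. -/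

import Mathlib

noncomputable section

namespace Heisenberg

section General

variable (A : Type) [AddCommGroup A] [Fintype A]

/-- The Hilbert space `L²(A)` of complex functions on the finite abelian group `A`. -/
abbrev L2 : Type := EuclideanSpace ℂ A

/-- The unitary group of `L²(A)`; the product is composition. -/
abbrev U : Type := L2 A ≃ₗᵢ[ℂ] L2 A

/-- The Pontryagin dual of `A`: homomorphisms from `A` to the unit circle, written additively,
so that `(χ + ψ) u = χ u * ψ u`. -/
abbrev Dual : Type := AddChar A Circle

/-- The group `K = A × Â`. -/
abbrev K : Type := A × Dual A

variable {A}

/-- The translation operator `(T_x f)(u) = f (u - x)`. -/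
def translation (x : A) : U A where
  toFun f := WithLp.toLp 2 fun u => f (u - x)
  invFun f := WithLp.toLp 2 fun u => f (u + x)
  map_add' _ _ := rfl
  map_smul' _ _ := rfl
  left_inv f := by ext u; simp
  right_inv f := by ext u; simp
  norm_map' f := by
    simp only [EuclideanSpace.norm_eq]
    congr 1
    exact Fintype.sum_equiv (Equiv.subRight x) _ _ fun u => rfl

/-- The modulation operator `(M_χ f)(u) = χ(u) f(u)`. -/
def modulation (χ : Dual A) : U A where
  toFun f := WithLp.toLp 2 fun u => (χ u : ℂ) * f u
  invFun f := WithLp.toLp 2 fun u => ((χ u)⁻¹ : ℂ) * f u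
  map_add' f g := by ext u; simp [mul_add]
  map_smul' c f := by ext u; simp [mul_left_comm]
  left_inv f := by ext u; simp
  right_inv f := by ext u; simp
  norm_map' f := by simp [EuclideanSpace.norm_eq, Circle.norm_coe]

/-- The scalar operator `z · id` for `z` on the unit circle. -/
def scalar (z : Circle) : U A where
  toFun f := WithLp.toLp 2 fun u => (z : ℂ) * f u
  invFun f := WithLp.toLp 2 fun u => (z⁻¹ : ℂ) * f u
  map_add' f g := by ext u; simp [mul_add]
  map_smul' c f := by ext u; simp [mul_left_comm]
  left_inv f := by ext u; simp
  right_inv f := by ext u; simp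
  norm_map' f := by simp [EuclideanSpace.norm_eq, Circle.norm_coe]

/-- The Weyl operator `W_k = T_x M_χ` for `k = (x, χ)`. -/
def weyl (k : K A) : U A := translation k.1 * modulation k.2

@[simp] theorem weyl_apply (k : K A) (f : L2 A) (u : A) :
    weyl k f u = (k.2 (u - k.1) : ℂ) * f (u - k.1) := rfl

@[simp] theorem scalar_apply (z : Circle) (f : L2 A) (u : A) :
    scalar z f u = (z : ℂ) * f u := rfl

theorem scalar_mul_weyl_mul (z w : Circle) (k l : K A) :
    (scalar z * weyl k) * (scalar w * weyl l) =
      scalar (z * w * k.2 l.1) * weyl (k + l) := by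
  ext f u
  have h1 : u - k.1 - l.1 = u - (k.1 + l.1) := by abel
  have h2 : k.2 (u - k.1) = k.2 l.1 * k.2 (u - (k.1 + l.1)) := by
    rw [← AddChar.map_add_eq_mul]
    congr 1
    abel
  simp only [LinearIsometryEquiv.coe_mul, Function.comp_apply, scalar_apply, weyl_apply, h1, h2, Prod.fst_add,
    Prod.snd_add, AddChar.add_apply, Circle.coe_mul]
  ring

theorem scalar_one_mul_weyl_zero : scalar 1 * weyl (0 : K A) = 1 := by
  ext f u
  simp

variable (A)

/-- The Heisenberg group `G` of `A`: all operators `z W_k` with `|z| = 1` and `k ∈ K`. -/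
def heisenbergGroup : Subgroup (U A) where
  carrier := {g | ∃ (z : Circle) (k : K A), g = scalar z * weyl k}
  one_mem' := ⟨1, 0, scalar_one_mul_weyl_zero.symm⟩
  mul_mem' := by
    rintro _ _ ⟨z, k, rfl⟩ ⟨w, l, rfl⟩
    exact ⟨_, _, scalar_mul_weyl_mul z w k l⟩
  inv_mem' := by
    rintro _ ⟨z, k, rfl⟩
    refine ⟨z⁻¹ * (k.2 (-k.1))⁻¹, -k, ?_⟩
    rw [inv_eq_iff_mul_eq_one, scalar_mul_weyl_mul, ← scalar_one_mul_weyl_zero, add_neg_cancel]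
    congr 2
    simp

variable {A}

/-- The embedding `j(z) = z W_0` of the circle as the centre of the Heisenberg group. -/
def j (z : Circle) : heisenbergGroup A := ⟨scalar z * weyl 0, z, 0, rfl⟩

variable (A)

/-- The group `B₀(G)` of automorphisms of the Heisenberg group that fix its centre pointwise. -/
def centreFixingAut : Subgroup (MulAut (heisenbergGroup A)) where
  carrier := {σ | ∀ z : Circle, σ (j z) = j z}
  one_mem' _ := rfl
  mul_mem' hσ hτ z := by rw [MulAut.mul_apply, hτ z, hσ z]
  inv_mem' := by
    intro σ hσ z
    rw [MulAut.inv_def, MulEquiv.symm_apply_eq]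
    exact (hσ z).symm

variable {A}

/-- The alternating form `e((x, χ), (y, ψ)) = χ(y) ψ(x)⁻¹` on `K`. -/
def e (k l : K A) : Circle := k.2 l.1 * (l.2 k.1)⁻¹

variable (A)

/-- The group `Aut(K, e)` of automorphisms of the abelian group `K` preserving `e`; the product is
composition. -/
def autKe : Subgroup (K A ≃ₗ[ℤ] K A) where
  carrier := {α | ∀ k l, e (α k) (α l) = e k l}
  one_mem' _ _ := rfl
  mul_mem' hα hβ k l := by rw [LinearEquiv.mul_apply, LinearEquiv.mul_apply, hα, hβ]
  inv_mem' := by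
    intro α hα k l
    rw [← hα]
    exact congrArg₂ e (α.apply_symm_apply k) (α.apply_symm_apply l)

variable {A}

/-- `x / 2` in a finite abelian group of odd order `N`, namely `((N + 1) / 2) • x`. -/
def half (x : A) : A := ((Fintype.card A + 1) / 2) • x

theorem two_nsmul_half (hA : Odd (Fintype.card A)) (x : A) : 2 • half x = x := by
  obtain ⟨m, hm⟩ := hA
  have h : 2 * ((Fintype.card A + 1) / 2) = Fintype.card A + 1 := by omega
  rw [half, ← mul_nsmul', h, add_nsmul, one_nsmul, card_nsmul_eq_zero, zero_add]

/-- The normalised Weyl operator `χ(x/2) W_k`, `k = (x, χ)`, as an element of the Heisenberg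
group (for `A` of odd order). -/
def normWeyl (k : K A) : heisenbergGroup A :=
  ⟨scalar (k.2 (half k.1)) * weyl k, _, k, rfl⟩

/-- `W` is (a choice of operators for) the Weil representation of `Aut(K, e)`, for `A` of odd order:
for every `α`, the unitary operator `W α` satisfies `W(α) g = σ(g) W(α)` for all `g` in the
Heisenberg group, where `σ` is the automorphism in `B₀(G)` attached to `α`, i.e. the one that sends
the normalised Weyl operator at `k` to the normalised Weyl operator at `α k`. -/
def IsWeilRepresentation (W : autKe A → U A) : Prop :=
  ∀ α : autKe A, ∃ σ ∈ centreFixingAut A,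
    (∀ k : K A, σ (normWeyl k) = normWeyl ((α : K A ≃ₗ[ℤ] K A) k)) ∧
    ∀ g : heisenbergGroup A, W α * (g : U A) = (σ g : U A) * W α

end General

section Projective

variable {A : Type} [AddCommGroup A] [Fintype A] {Γ : Type} [Group Γ] (W : Γ → U A)

/-- `W` is a projective unitary representation: `W(σ) W(τ) = c(σ, τ) W(σ τ)`, `|c(σ, τ)| = 1`. -/
def IsProjectiveRepresentation : Prop :=
  ∃ c : Γ → Γ → Circle, ∀ σ τ : Γ, W σ * W τ = scalar (c σ τ) * W (σ * τ)

/-- The subspace `V` is stable under all the operators `W γ`. -/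
def IsInvariant (V : Submodule ℂ (L2 A)) : Prop :=
  ∀ γ : Γ, ∀ v ∈ V, W γ v ∈ V

/-- `V` is an irreducible subrepresentation. -/
def IsIrreducibleSub (V : Submodule ℂ (L2 A)) : Prop :=
  IsInvariant W V ∧ V ≠ ⊥ ∧ ∀ V' ≤ V, IsInvariant W V' → V' = ⊥ ∨ V' = V

/-- The invariant subspaces `V` and `V'` are isomorphic as projective representations with the same
cocycle, i.e. as modules over the twisted group ring: there is a linear isomorphism `T` with
`T (W γ v) = W γ (T v)`. -/
def AreIsomorphic (V V' : Submodule ℂ (L2 A)) : Prop :=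
  ∃ T : V ≃ₗ[ℂ] V', ∀ (γ : Γ) (v w : V), (w : L2 A) = W γ v → (T w : L2 A) = W γ (T v)

/-- `L²(A)` is the direct sum of `m` irreducible, pairwise non-isomorphic subrepresentations. -/
def HasMultiplicityFreeDecomposition (m : ℕ) : Prop :=
  ∃ V : Fin m → Submodule ℂ (L2 A), DirectSum.IsInternal V ∧
    (∀ i, IsIrreducibleSub W (V i)) ∧ ∀ i i', i ≠ i' → ¬ AreIsomorphic W (V i) (V i')

end Projective

/-- The character `χ_y(u) = exp(2πi (y ⬝ u) / N)` of `(ℤ/N)^g`. -/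
def dotChar {N g : ℕ} [NeZero N] (y : Fin g → ZMod N) : Dual (Fin g → ZMod N) where
  toFun u := ZMod.toCircle (dotProduct y u)
  map_zero_eq_one' := by simp
  map_add_eq_mul' u v := by rw [dotProduct_add, AddChar.map_add_eq_mul]

end Heisenberg

end

/-! Since $|A|$ is odd, the normalised Weyl operators satisfy $\mathcal W_k\mathcal
W_l=e(k/2,l)\,\mathcal W_{k+l}$, so an automorphism preserving $e$ preserves their multiplication
table. They form a basis of $\mathrm{End}(L^2(A))$: independence reduces to that of characters, and
$|K|=|A|^2$. Hence an operator commuting with all of them is scalar (Schur). Averaging over $K$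
produces a nonzero intertwiner between $\mathcal W_k$ and $\mathcal W_{\alpha(k)}$, which Schur
makes unitary after rescaling (`exists_implements`). Schur also gives uniqueness up to $U(1)$, hence
projectivity.

Conjugation by $W(\alpha)$ permutes the Weyl basis as $\alpha$ permutes $K$, so the commutant of $W$
has the orbit sums of $\mathrm{Aut}(K,e)$ on $K$ as a basis. Over the local ring $\mathbf Z/p^n$,
symplectic transvections show that the orbits are the sets of elements of order $p^j$, $0\le j\le n$
(`exists_autKe_eq`), so the commutant has dimension $n+1$. It is commutative by Gelfand's trick:
transposition reverses products but fixes every orbit sum. A commutative commutant of dimension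
$n+1$, spanned by Hermitian operators, gives $n+1$ joint eigenspaces; these are the irreducible
constituents (`hasMultiplicityFreeDecomposition_of_commutant`). -/

noncomputable section

namespace Heisenberg

/-! ### Commutative commutants and multiplicity-free decompositions -/

section Commutant

variable {A : Type} [Fintype A] {Γ : Type} {W : Γ → U A}

theorem map_mem_iff_of_map_le {V : Submodule ℂ (L2 A)} {w : U A} (h : ∀ v ∈ V, w v ∈ V) (v : L2 A) :
    w v ∈ V ↔ v ∈ V := by
  refine ⟨fun hv => ?_, h v⟩
  have hle : V.map w.toLinearEquiv.toLinearMap ≤ V := by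
    rintro _ ⟨x, hx, rfl⟩
    exact h x hx
  have heq : V.map w.toLinearEquiv.toLinearMap = V :=
    Submodule.eq_of_le_of_finrank_eq hle (LinearEquiv.finrank_map_eq w.toLinearEquiv V)
  obtain ⟨x, hx, hxv⟩ := heq.ge hv
  rwa [← w.injective hxv]

/-- By finite dimension each unitary `W γ` maps `V` onto itself, so it also preserves the orthogonal
complement. -/
theorem IsInvariant.starProjection_map {V : Submodule ℂ (L2 A)} (hV : IsInvariant W V) (γ : Γ)
    (v : L2 A) : V.starProjection (W γ v) = W γ (V.starProjection v) := by
  refine Submodule.eq_starProjection_of_mem_of_inner_eq_zero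
    (hV γ _ (Submodule.starProjection_apply_mem V v)) fun x hx => ?_
  obtain ⟨y, rfl⟩ := (W γ).surjective x
  rw [← map_sub, LinearIsometryEquiv.inner_map_map]
  exact Submodule.starProjection_inner_eq_zero v y ((map_mem_iff_of_map_le (hV γ) y).1 hx)

/-- If the commutant of `W` has a basis of `m` commuting symmetric operators, then `W` has a
multiplicity-free decomposition into `m` irreducible subrepresentations. -/
theorem hasMultiplicityFreeDecomposition_of_commutant {m : ℕ} (T : Fin m → Module.End ℂ (L2 A))
    (hsymm : ∀ i, (T i).IsSymmetric) (hcomm : ∀ i j, Commute (T i) (T j))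
    (hli : LinearIndependent ℂ T)
    (hmem : ∀ i γ v, T i (W γ v) = W γ (T i v))
    (hspan : ∀ X : Module.End ℂ (L2 A), (∀ γ v, X (W γ v) = W γ (X v)) →
      X ∈ Submodule.span ℂ (Set.range T)) :
    HasMultiplicityFreeDecomposition W m := by
  classical
  let E : (Fin m → ℂ) → Submodule ℂ (L2 A) := fun c => ⨅ j, Module.End.eigenspace (T j) (c j)
  have memE : ∀ c v, v ∈ E c ↔ ∀ j, T j v = c j • v := fun c v => by
    simp [E, Submodule.mem_iInf]
  have hint : DirectSum.IsInternal E :=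
    LinearMap.IsSymmetric.directSum_isInternal_of_pairwise_commute hsymm fun i j _ => hcomm i j
  have horth : OrthogonalFamily ℂ (fun c => E c) fun c => (E c).subtypeₗᵢ :=
    LinearMap.IsSymmetric.orthogonalFamily_iInf_eigenspaces hsymm
  let S := {c // E c ≠ ⊥}
  have hintS : DirectSum.IsInternal fun s : S => E s := DirectSum.isInternal_ne_bot_iff.2 hint
  have : Fintype S :=
    (WellFoundedGT.finite_ne_bot_of_iSupIndep hint.submodule_iSupIndep).fintype
  have hinv : ∀ c, IsInvariant W (E c) := fun c γ v hv => (memE _ _).2 fun j => by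
    rw [hmem, (memE _ _).1 hv j, map_smul]
  have hact : ∀ (a : Fin m → ℂ) c, ∀ v ∈ E c, (∑ i, a i • T i) v = (∑ i, a i * c i) • v :=
    fun a c v hv => by
      simp [LinearMap.sum_apply, (memE _ _).1 hv, Finset.sum_smul, mul_smul]
  -- Every operator in the commutant acts on each joint eigenspace as a scalar.
  have hscal : ∀ X : Module.End ℂ (L2 A), (∀ γ v, X (W γ v) = W γ (X v)) →
      ∃ a : Fin m → ℂ, ∀ c, ∀ v ∈ E c, X v = (∑ i, a i * c i) • v := fun X hX => by
    obtain ⟨a, rfl⟩ := (Submodule.mem_span_range_iff_exists_fun ℂ).1 (hspan X hX)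
    exact ⟨a, hact a⟩
  have hdisj : ∀ c c', c ≠ c' → ∀ v ∈ E c, v ∈ E c' → v = 0 := fun c c' hcc v hv hv' =>
    inner_self_eq_zero.1 (horth hcc ⟨v, hv⟩ ⟨v, hv'⟩)
  have hcard : Fintype.card S = m := by
    -- Reading off joint eigenvalues is injective because the `T i` are independent, and surjective
    -- because the projections onto the `E s` lie in the commutant. Hence there are exactly `m`
    -- nonzero joint eigenspaces.
    let Λ : (Fin m → ℂ) →ₗ[ℂ] S → ℂ :=
      { toFun := fun a s => ∑ i, a i * s.1 i
        map_add' := fun a b => by ext s; simp [add_mul, Finset.sum_add_distrib]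
        map_smul' := fun r a => by ext s; simp [mul_assoc, Finset.mul_sum] }
    have hinj : Function.Injective Λ := by
      rw [← LinearMap.ker_eq_bot, LinearMap.ker_eq_bot']
      intro a ha
      have hzero : ∑ i, a i • T i = 0 := by
        rw [← LinearMap.ker_eq_top, eq_top_iff, ← hintS.submodule_iSup_eq_top]
        refine iSup_le fun s v hv => ?_
        rw [LinearMap.mem_ker, hact a s v hv]
        have := congrFun ha s
        change ∑ i, a i * s.1 i = 0 at this
        rw [this, zero_smul]
      exact funext (Fintype.linearIndependent_iff.1 hli a hzero)
    have hsurj : Function.Surjective Λ := fun b => by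
      obtain ⟨a, ha⟩ := hscal (∑ s : S, b s • ((E s).starProjection : L2 A →ₗ[ℂ] L2 A))
        fun γ v => by
          simp [LinearMap.sum_apply, (hinv _).starProjection_map]
      refine ⟨a, funext fun s => ?_⟩
      obtain ⟨v, hv, hv0⟩ := Submodule.exists_mem_ne_zero_of_ne_bot s.2
      have h := ha s v hv
      rw [LinearMap.sum_apply, Finset.sum_eq_single s] at h
      · rw [LinearMap.smul_apply, ContinuousLinearMap.coe_coe,
          Submodule.starProjection_eq_self_iff.2 hv] at h
        exact (smul_left_injective ℂ hv0 h).symm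
      · intro t _ hts
        have : (E t).starProjection v = 0 := by
          rw [Submodule.starProjection_apply_eq_zero_iff]
          exact fun u hu => horth (fun h => hts (Subtype.ext h)) ⟨u, hu⟩ ⟨v, hv⟩
        simp [this]
      · simp
    simpa using (LinearEquiv.ofBijective Λ ⟨hinj, hsurj⟩).finrank_eq.symm
  let f : Fin m ≃ S := (Fintype.equivFinOfCardEq hcard).symm
  refine ⟨fun i => E (f i), ?_, fun i => ⟨hinv _, (f i).2, fun V' hle hV' => ?_⟩, ?_⟩
  · rw [DirectSum.isInternal_submodule_iff_iSupIndep_and_iSup_eq_top]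
    refine ⟨hintS.submodule_iSupIndep.comp f.injective, ?_⟩
    rw [← hintS.submodule_iSup_eq_top]
    exact f.iSup_comp (g := fun s : S => E s)
  · refine or_iff_not_imp_left.2 fun hne => le_antisymm hle fun u hu => ?_
    -- The projection onto `V'` is scalar on the eigenspace, and a nonzero vector of `V'` forces the
    -- scalar to be 1.
    obtain ⟨a, ha⟩ := hscal (V'.starProjection : L2 A →ₗ[ℂ] L2 A) fun γ v =>
      hV'.starProjection_map γ v
    obtain ⟨v, hv, hv0⟩ := Submodule.exists_mem_ne_zero_of_ne_bot hne
    have h1 : (1 : ℂ) • v = (∑ i', a i' * (f i).1 i') • v := by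
      rw [one_smul, ← ha _ v (hle hv), ContinuousLinearMap.coe_coe,
        Submodule.starProjection_eq_self_iff.2 hv]
    have h2 := ha _ u hu
    rw [← smul_left_injective ℂ hv0 h1, one_smul] at h2
    exact Submodule.starProjection_eq_self_iff.1 h2
  · rintro i i' hii ⟨Q, hQ⟩
    obtain ⟨v, hv, hv0⟩ := Submodule.exists_mem_ne_zero_of_ne_bot (f i).2
    let P := (E (f i)).orthogonalProjectionOnto
    have hP : ∀ v, (P v : L2 A) = (E (f i)).starProjection v := fun v => rfl
    -- An isomorphism `Q`, extended by zero on the orthogonal complement, lies in the commutant and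
    -- so maps `E (f i)` into itself; its image also lies in `E (f i')`, which meets `E (f i)` only
    -- in 0.
    obtain ⟨a, ha⟩ := hscal
      ((E (f i')).subtype ∘ₗ Q.toLinearMap ∘ₗ (P : L2 A →ₗ[ℂ] E (f i))) fun γ v => by
        refine hQ γ (P v) (P (W γ v)) ?_
        rw [hP, hP, (hinv _).starProjection_map]
    have h : (Q (P v) : L2 A) = _ := ha _ v hv
    have hPv : P v = ⟨v, hv⟩ := Subtype.ext (Submodule.starProjection_eq_self_iff.2 hv)
    have h0 := hdisj _ _ (fun h => hii (f.injective (Subtype.ext h))) _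
      (h ▸ Submodule.smul_mem _ _ hv) (Subtype.coe_prop (Q (P v)))
    rw [ZeroMemClass.coe_eq_zero, LinearEquiv.map_eq_zero_iff, hPv] at h0
    exact hv0 (congrArg Subtype.val h0)

end Commutant

/-! ### The Weyl basis of the matrix algebra -/

section WeylMatrix

variable {A : Type} [AddCommGroup A] [Fintype A]

theorem half_add (x y : A) : half (x + y) = half x + half y := nsmul_add _ _ _

theorem half_neg (x : A) : half (-x) = -half x := smul_neg _ _

theorem half_add_half (hA : Odd (Fintype.card A)) (x : A) : half x + half x = x := by
  rw [← two_nsmul, two_nsmul_half hA]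

theorem half_self_add (hA : Odd (Fintype.card A)) (x : A) : half (x + x) = x := by
  rw [half_add, half_add_half hA]

theorem card_dual : Nat.card (Dual A) = Fintype.card A := by
  rw [Nat.card_congr AddChar.circleEquivComplex.toEquiv, Nat.card_eq_fintype_card, AddChar.card_eq]

instance : Finite (Dual A) := Finite.of_equiv _ (AddChar.circleEquivComplex (α := A)).symm.toEquiv

instance : Fintype (Dual A) := Fintype.ofFinite _

theorem card_K : Fintype.card (K A) = Fintype.card A * Fintype.card A := by
  rw [Fintype.card_prod, ← Nat.card_eq_fintype_card (α := Dual A), card_dual]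

variable [DecidableEq A]

/-- The matrix of the normalised Weyl operator at `k`. -/
def weylMatrix (k : K A) : Matrix A A ℂ := fun u v =>
  if u - v = k.1 then (k.2 (half (u + v)) : ℂ) else 0

theorem normWeyl_apply (hA : Odd (Fintype.card A)) (k : K A) (f : L2 A) :
    (normWeyl k : U A) f = Matrix.toEuclideanCLM (𝕜 := ℂ) (weylMatrix k) f := by
  ext u
  have h : half (u + (u - k.1)) = half k.1 + (u - k.1) := by
    nth_rewrite 3 [← half_add_half hA u]
    nth_rewrite 3 [← half_add_half hA k.1]
    rw [half_add, sub_eq_add_neg, half_add, half_neg]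
    abel
  rw [Matrix.ofLp_toEuclideanCLM, Matrix.mulVec_eq_sum, Finset.sum_apply,
    Finset.sum_eq_single (u - k.1)]
  · simp [weylMatrix, normWeyl, h, AddChar.map_add_eq_mul]
    ring
  · intro v _ hv
    have : u - v ≠ k.1 := fun h => hv (by rw [← h]; abel)
    simp [weylMatrix, this]
  · simp

theorem weylMatrix_neg (k : K A) : weylMatrix (-k) = (weylMatrix k).conjTranspose := by
  ext u v
  have h : u - v = -k.1 ↔ v - u = k.1 := by rw [← neg_inj, neg_neg, neg_sub]
  simp only [weylMatrix, Matrix.conjTranspose_apply, Prod.fst_neg, Prod.snd_neg, h, add_comm v u]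
  split_ifs
  · rw [AddChar.neg_apply, AddChar.map_neg_eq_inv, Circle.coe_inv_eq_conj]
    rfl
  · simp

/-- The phase depends on `u + v` only, so swapping the indices just reverses the translation. This
is what Gelfand's trick needs. -/
theorem weylMatrix_transpose (k : K A) : (weylMatrix k).transpose = weylMatrix (-k.1, k.2) := by
  ext u v
  have h : u - v = -k.1 ↔ v - u = k.1 := by rw [← neg_inj, neg_neg, neg_sub]
  simp only [weylMatrix, Matrix.transpose_apply, h, add_comm v u]

theorem weylMatrix_zero : weylMatrix (0 : K A) = 1 := by
  ext u v
  simp [weylMatrix, Matrix.one_apply, sub_eq_zero]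

/-- The square root of the alternating form `e`. -/
def halfForm (k l : K A) : Circle := k.2 (half l.1) * (l.2 (half k.1))⁻¹

theorem weylMatrix_mul (hA : Odd (Fintype.card A)) (k l : K A) :
    weylMatrix k * weylMatrix l = (halfForm k l : ℂ) • weylMatrix (k + l) := by
  ext u v
  rw [Matrix.mul_apply, Finset.sum_eq_single (v + l.1)]
  · have h : u - (v + l.1) = k.1 ↔ u - v = k.1 + l.1 := by
      rw [← sub_sub, sub_eq_iff_eq_add]
    simp only [weylMatrix, h, Matrix.smul_apply, Prod.fst_add, Prod.snd_add, add_sub_cancel_left,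
      if_true, smul_eq_mul]
    split_ifs with huv
    · have hu : u = v + l.1 + k.1 := by
        rw [← sub_eq_iff_eq_add', ← sub_sub, huv, add_sub_cancel_right]
      have h1 : half (u + (v + l.1)) = half l.1 + half (u + v) := by
        simp only [half_add]; abel
      have h2 : half (v + l.1 + v) = -half k.1 + half (u + v) := by
        rw [hu]
        have := half_add_half hA v
        simp only [half_add]
        abel
      rw [h1, h2, halfForm]
      simp only [← Circle.coe_mul]
      congr 1
      simp only [AddChar.map_add_eq_mul, AddChar.add_apply, AddChar.map_neg_eq_inv]
      ac_rfl
    · simp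
  · intro w _ hw
    have : w - v ≠ l.1 := fun h => hw (by rw [← h]; abel)
    simp [weylMatrix, this]
  · simp

/-- Along the diagonal `u - v = x`, parametrised by `u = w + x/2`, `v = w - x/2`, the entry at `(x,
χ)` is `χ w`, so independence of characters applies for each `x` separately. -/
theorem weylMatrix_linearIndependent (hA : Odd (Fintype.card A)) :
    LinearIndependent ℂ (weylMatrix : K A → Matrix A A ℂ) := by
  rw [Fintype.linearIndependent_iff]
  intro c hc
  have hchar := Fintype.linearIndependent_iff.1 (AddChar.linearIndependent A ℂ)
  suffices h : ∀ (x : A), ∀ ψ : AddChar A ℂ, c (x, AddChar.circleEquivComplex.symm ψ) = 0 by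
    rintro ⟨x, χ⟩
    simpa using h x (AddChar.circleEquivComplex χ)
  refine fun x => hchar _ (funext fun w => ?_)
  have h := congrFun (congrFun hc (w + half x)) (w - half x)
  have hx : w + half x - (w - half x) = x := by
    rw [add_sub_sub_cancel, half_add_half hA]
  have hw : half (w + half x + (w - half x)) = w := by
    rw [add_add_sub_cancel, half_self_add hA]
  rw [Matrix.sum_apply, Fintype.sum_prod_type, Finset.sum_eq_single x] at h
  · rw [Finset.sum_apply, ← Equiv.sum_comp AddChar.circleEquivComplex.toEquiv]
    rw [Matrix.zero_apply] at h
    rw [Pi.zero_apply, ← h]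
    refine Finset.sum_congr rfl fun χ _ => ?_
    simp [weylMatrix, hx, half_self_add hA]
    left; rfl
  · intro y _ hy
    exact Finset.sum_eq_zero fun χ _ => by simp [weylMatrix, hx, hy.symm]
  · simp

/-- The normalised Weyl operators form a basis of the space of matrices. -/
def weylBasis (hA : Odd (Fintype.card A)) : Module.Basis (K A) ℂ (Matrix A A ℂ) :=
  haveI : Nonempty (K A) := ⟨0⟩
  basisOfLinearIndependentOfCardEqFinrank (weylMatrix_linearIndependent hA) (by
    rw [card_K, Module.finrank_matrix, Module.finrank_self, mul_one])

@[simp] theorem weylBasis_apply (hA : Odd (Fintype.card A)) (k : K A) :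
    weylBasis hA k = weylMatrix k := by
  simp [weylBasis]

end WeylMatrix

/-! ### Unitary operators as matrices -/

section OpMatrix

variable {A : Type} [Fintype A] [DecidableEq A]

open Matrix

/-- The matrix of a unitary operator. -/
def opMatrix (w : U A) : Matrix A A ℂ :=
  (toEuclideanCLM (n := A) (𝕜 := ℂ)).symm (w : L2 A →L[ℂ] L2 A)

theorem toEuclideanCLM_opMatrix (w : U A) :
    toEuclideanCLM (𝕜 := ℂ) (opMatrix w) = (w : L2 A →L[ℂ] L2 A) :=
  StarAlgEquiv.apply_symm_apply _ _

theorem opMatrix_mul (w w' : U A) : opMatrix (w * w') = opMatrix w * opMatrix w' :=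
  map_mul (toEuclideanCLM (n := A) (𝕜 := ℂ)).symm (w : L2 A →L[ℂ] L2 A) w'

theorem opMatrix_one : opMatrix (1 : U A) = 1 :=
  map_one (toEuclideanCLM (n := A) (𝕜 := ℂ)).symm

theorem opMatrix_injective : Function.Injective (opMatrix : U A → Matrix A A ℂ) := fun w w' h => by
  have := congrArg (toEuclideanCLM (n := A) (𝕜 := ℂ)) h
  rw [toEuclideanCLM_opMatrix, toEuclideanCLM_opMatrix] at this
  exact LinearIsometryEquiv.ext fun f => DFunLike.congr_fun this f

theorem opMatrix_mul_inv (w : U A) : opMatrix w * opMatrix w⁻¹ = 1 := by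
  rw [← opMatrix_mul, mul_inv_cancel, opMatrix_one]

theorem exists_opMatrix_eq {M : Matrix A A ℂ} (hM : M.conjTranspose * M = 1) :
    ∃ w : U A, opMatrix w = M := by
  have hM' : M * M.conjTranspose = 1 := mul_eq_one_comm.1 hM
  have hu : toEuclideanCLM (n := A) (𝕜 := ℂ) M ∈ unitary (L2 A →L[ℂ] L2 A) := by
    rw [Unitary.mem_iff, ← map_star, ← map_mul, ← map_mul, star_eq_conjTranspose, hM, hM']
    simp
  refine ⟨Unitary.linearIsometryEquiv ⟨_, hu⟩, ?_⟩
  exact StarAlgEquiv.symm_apply_apply toEuclideanCLM M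

end OpMatrix

/-! ### Schur's lemma and operators implementing automorphisms -/

section StoneVonNeumann

variable {A : Type} [AddCommGroup A] [Fintype A]

/-- Halving is multiplication by an integer, so it commutes with every automorphism; invariance of
`halfForm` then follows from that of `e`. -/
theorem halfForm_eq (k l : K A) : halfForm k l = e (((Fintype.card A + 1) / 2) • k) l := by
  simp [halfForm, e, half, AddChar.nsmul_apply, AddChar.map_nsmul_eq_pow]

theorem halfForm_map {α : K A ≃ₗ[ℤ] K A} (hα : α ∈ autKe A) (k l : K A) :
    halfForm (α k) (α l) = halfForm k l := by
  rw [halfForm_eq, halfForm_eq, ← map_nsmul, hα]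

/-- The equality of phases that makes the twisted average an intertwiner. -/
theorem halfForm_neg_add (l m : K A) : halfForm (-(l + m)) l = halfForm l m := by
  simp only [halfForm, Prod.snd_neg, Prod.snd_add, Prod.fst_neg, Prod.fst_add, half_neg, half_add,
    AddChar.neg_apply, AddChar.add_apply, AddChar.map_neg_eq_inv, AddChar.map_add_eq_mul, mul_inv,
    inv_inv, neg_add]
  rw [mul_mul_mul_comm, inv_mul_cancel, one_mul, mul_comm]

/-- The unitary operator `w` implements `α`. -/
def Implements (w : U A) (α : K A ≃ₗ[ℤ] K A) : Prop :=
  ∀ k : K A, w * (normWeyl k : U A) = (normWeyl (α k) : U A) * w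

theorem Implements.mul {w w' : U A} {α β : K A ≃ₗ[ℤ] K A} (h : Implements w α)
    (h' : Implements w' β) : Implements (w * w') (α * β) := fun k => by
  rw [mul_assoc, h', ← mul_assoc, h, mul_assoc]
  rfl

theorem Implements.inv {w : U A} {α : K A ≃ₗ[ℤ] K A} (h : Implements w α) :
    Implements w⁻¹ α⁻¹ := fun k => by
  rw [inv_mul_eq_iff_eq_mul, ← mul_assoc, h, mul_inv_cancel_right]
  exact congrArg (fun k => (normWeyl k : U A)) (α.apply_symm_apply k).symm

theorem IsWeilRepresentation.implements {W : autKe A → U A} (hW : IsWeilRepresentation W)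
    (α : autKe A) : Implements (W α) α := fun k => by
  obtain ⟨σ, -, hσ, h⟩ := hW α
  rw [h, hσ]

theorem Implements.conj_mem {w : U A} {α : K A ≃ₗ[ℤ] K A} (h : Implements w α)
    (g : heisenbergGroup A) : w * g * w⁻¹ ∈ heisenbergGroup A := by
  obtain ⟨_, z, k, rfl⟩ := g
  have hk : (scalar z * weyl k : U A) =
      scalar (z * (k.2 (half k.1))⁻¹) * (normWeyl k : U A) := by
    ext f u
    simp [normWeyl, mul_assoc]
  have hs : ∀ y, w * scalar y = scalar y * w := fun y => by
    ext1 f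
    exact map_smul w (y : ℂ) f
  change w * (scalar z * weyl k) * w⁻¹ ∈ heisenbergGroup A
  rw [hk, ← mul_assoc, hs, mul_assoc (scalar _), h, ← mul_assoc, mul_inv_cancel_right]
  refine ⟨z * (k.2 (half k.1))⁻¹ * (α k).2 (half (α k).1), α k, ?_⟩
  ext f u
  simp [normWeyl]
  ring

/-- The automorphism of the Heisenberg group is conjugation by `W α`, which fixes scalars by
linearity. -/
theorem isWeilRepresentation_of_implements {W : autKe A → U A}
    (hW : ∀ α : autKe A, Implements (W α) α) : IsWeilRepresentation W := fun α => by
  let σ : MulAut (heisenbergGroup A) :=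
    { toFun := fun g => ⟨W α * g * (W α)⁻¹, (hW α).conj_mem g⟩
      invFun := fun g => ⟨(W α)⁻¹ * g * (W α)⁻¹⁻¹, (hW α).inv.conj_mem g⟩
      left_inv := fun g => Subtype.ext (by group)
      right_inv := fun g => Subtype.ext (by group)
      map_mul' := fun g h => Subtype.ext (by
        change W α * (g * h : U A) * (W α)⁻¹ = (W α * g * (W α)⁻¹) * (W α * h * (W α)⁻¹)
        group) }
  refine ⟨σ, fun z => Subtype.ext ?_, fun k => Subtype.ext ?_, fun g => ?_⟩
  · change W α * (scalar z * weyl 0) * (W α)⁻¹ = scalar z * weyl 0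
    rw [mul_inv_eq_iff_eq_mul]
    ext1 f
    have : ∀ f : L2 A, (scalar z * weyl 0 : U A) f = (z : ℂ) • f := fun f => by
      ext u
      simp
    change W α ((scalar z * weyl 0 : U A) f) = (scalar z * weyl 0 : U A) (W α f)
    rw [this, this, map_smul]
  · change W α * (normWeyl k : U A) * (W α)⁻¹ = _
    rw [hW, mul_inv_cancel_right]
  · change W α * (g : U A) = W α * g * (W α)⁻¹ * W α
    rw [inv_mul_cancel_right]

variable [DecidableEq A]

open Matrix ComplexOrder

theorem opMatrix_normWeyl (hA : Odd (Fintype.card A)) (k : K A) :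
    opMatrix (normWeyl k : U A) = weylMatrix k := by
  rw [opMatrix, ← StarAlgEquiv.symm_apply_apply toEuclideanCLM (weylMatrix k)]
  congr 1
  ext1 f
  exact normWeyl_apply hA k f

/-- Schur's lemma for the Heisenberg group. -/
theorem exists_eq_smul_one_of_commute (hA : Odd (Fintype.card A)) {X : Matrix A A ℂ}
    (hX : ∀ k : K A, Commute (weylMatrix k) X) : ∃ c : ℂ, X = c • 1 := by
  have hall : ∀ Y : Matrix A A ℂ, Commute Y X := fun Y => by
    rw [← (weylBasis hA).sum_repr Y]
    refine Commute.sum_left _ _ _ fun k _ => ?_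
    rw [weylBasis_apply]
    exact (hX k).smul_left _
  obtain ⟨c, hc⟩ := mem_range_scalar_of_commute_single (M := X) fun i j _ => hall _
  exact ⟨c, by rw [← hc, smul_one_eq_diagonal]; rfl⟩

theorem Implements.opMatrix_mul_weylMatrix (hA : Odd (Fintype.card A)) {w : U A} {α : K A ≃ₗ[ℤ] K A}
    (h : Implements w α) (k : K A) :
    opMatrix w * weylMatrix k = weylMatrix (α k) * opMatrix w := by
  rw [← opMatrix_normWeyl hA, ← opMatrix_normWeyl hA, ← opMatrix_mul, ← opMatrix_mul, h]

/-- The quotient of the two operators commutes with all Weyl operators, so it is scalar by Schur, of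
modulus 1 by unitarity. -/
theorem Implements.exists_eq_scalar_mul (hA : Odd (Fintype.card A)) {w w' : U A}
    {α : K A ≃ₗ[ℤ] K A} (h : Implements w α) (h' : Implements w' α) :
    ∃ z : Circle, w = scalar z * w' := by
  have hcomm : Implements (w * w'⁻¹) 1 := mul_inv_cancel α ▸ h.mul h'.inv
  obtain ⟨c, hc⟩ := exists_eq_smul_one_of_commute hA fun k => (hcomm.opMatrix_mul_weylMatrix hA k).symm
  have happ : ∀ f, (w * w'⁻¹) f = c • f := fun f => by
    have := DFunLike.congr_fun (toEuclideanCLM_opMatrix (w * w'⁻¹)) f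
    rw [hc] at this
    change ((w * w'⁻¹ : U A) : L2 A →L[ℂ] L2 A) f = _
    rw [← this]
    simp
  obtain ⟨f, hf⟩ := exists_ne (0 : L2 A)
  have hnorm : ‖c‖ = 1 := by
    have := (w * w'⁻¹).norm_map f
    rwa [happ, norm_smul, mul_eq_right₀ (norm_ne_zero_iff.2 hf)] at this
  refine ⟨⟨c, mem_sphere_zero_iff_norm.2 hnorm⟩, ?_⟩
  rw [← mul_inv_eq_iff_eq_mul]
  ext f u
  rw [happ]
  rfl

/-- The average of `X` over the Heisenberg group, twisted by `α`. -/
def twistedAverage (α : K A ≃ₗ[ℤ] K A) (X : Matrix A A ℂ) : Matrix A A ℂ :=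
  ∑ k : K A, weylMatrix (α k) * X * weylMatrix (-k)

theorem twistedAverage_mul (hA : Odd (Fintype.card A)) {α : K A ≃ₗ[ℤ] K A} (hα : α ∈ autKe A)
    (X : Matrix A A ℂ) (l : K A) :
    twistedAverage α X * weylMatrix l = weylMatrix (α l) * twistedAverage α X := by
  rw [twistedAverage, Finset.sum_mul, Finset.mul_sum, ← Equiv.sum_comp (Equiv.addLeft l)]
  refine Finset.sum_congr rfl fun m _ => ?_
  rw [Equiv.coe_addLeft, mul_assoc, weylMatrix_mul hA, halfForm_neg_add, ← mul_assoc, ← mul_assoc,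
    weylMatrix_mul hA, halfForm_map hα, map_add, neg_add, neg_add_cancel_comm]
  simp

/-- If all averages vanished, the matrix units `single a 0 1`, read in column 0, would give a linear
relation between the `weylMatrix (α k)` whose coefficient at `k = 0` is 1. -/
theorem exists_twistedAverage_ne_zero (hA : Odd (Fintype.card A)) (α : K A ≃ₗ[ℤ] K A) :
    ∃ X, twistedAverage α X ≠ 0 := by
  by_contra! h
  have hli : LinearIndependent ℂ fun k : K A => weylMatrix (α k) :=
    (weylMatrix_linearIndependent hA).comp α α.injective
  have hzero := Fintype.linearIndependent_iff.1 hli (fun k => weylMatrix (-k) 0 0) (by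
    ext i a
    have := congrFun (congrFun (h (single a 0 1)) i) 0
    rw [twistedAverage, Matrix.sum_apply] at this
    rw [Matrix.sum_apply]
    refine Eq.trans ?_ this
    refine Finset.sum_congr rfl fun k _ => ?_
    rw [mul_apply, Finset.sum_eq_single 0]
    · simp [mul_comm]
    · intro b _ hb
      simp [hb]
    · simp) 0
  rw [neg_zero, weylMatrix_zero, one_apply_eq] at hzero
  exact one_ne_zero hzero

theorem exists_implements (hA : Odd (Fintype.card A)) {α : K A ≃ₗ[ℤ] K A} (hα : α ∈ autKe A) :
    ∃ w : U A, Implements w α := by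
  obtain ⟨X, hX⟩ := exists_twistedAverage_ne_zero hA α
  set T := twistedAverage α X
  have hT : ∀ l, T * weylMatrix l = weylMatrix (α l) * T := twistedAverage_mul hA hα X
  have hT' : ∀ l, weylMatrix l * Tᴴ = Tᴴ * weylMatrix (α l) := fun l => by
    have := congrArg conjTranspose (hT (-l))
    rwa [conjTranspose_mul, conjTranspose_mul, map_neg, ← weylMatrix_neg, ← weylMatrix_neg,
      neg_neg, neg_neg] at this
  -- By Schur `Tᴴ * T` is a scalar, positive since `T ≠ 0`; dividing `T` by its square root gives a
  -- unitary.
  obtain ⟨c, hc⟩ := exists_eq_smul_one_of_commute hA (X := Tᴴ * T) fun k => by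
    rw [Commute, SemiconjBy, ← mul_assoc, hT', mul_assoc, ← hT, mul_assoc]
  have hc0 : c ≠ 0 := by
    rintro rfl
    rw [zero_smul, conjTranspose_mul_self_eq_zero] at hc
    exact hX hc
  have hpos : 0 ≤ c := by
    have := (posSemidef_conjTranspose_mul_self T).diag_nonneg (i := (0 : A))
    rwa [hc, Matrix.smul_apply, one_apply_eq, smul_eq_mul, mul_one] at this
  obtain ⟨r, hr, rfl⟩ : ∃ r : ℝ, 0 ≤ r ∧ (r : ℂ) = c :=
    ⟨c.re, (Complex.nonneg_iff.1 hpos).1, Complex.ext rfl (Complex.nonneg_iff.1 hpos).2⟩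
  obtain ⟨w, hw⟩ := exists_opMatrix_eq (M := ((√r)⁻¹ : ℂ) • T) (by
    rw [conjTranspose_smul, smul_mul_smul_comm, hc, smul_smul]
    convert one_smul ℂ (1 : Matrix A A ℂ)
    have h1 : ((√r : ℝ) : ℂ) * (√r : ℝ) = r := by rw [← Complex.ofReal_mul, Real.mul_self_sqrt hr]
    have h2 : ((√r : ℝ) : ℂ) ≠ 0 := fun h => hc0 (by rw [← h1, h, zero_mul])
    simp only [star_inv₀, RCLike.star_def, Complex.conj_ofReal]
    rw [← h1]
    field_simp)
  refine ⟨w, fun k => opMatrix_injective ?_⟩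
  rw [opMatrix_mul, opMatrix_mul, opMatrix_normWeyl hA, opMatrix_normWeyl hA, hw, smul_mul_assoc,
    mul_smul_comm, hT]

theorem IsWeilRepresentation.isProjectiveRepresentation (hA : Odd (Fintype.card A))
    {W : autKe A → U A} (hW : IsWeilRepresentation W) : IsProjectiveRepresentation W := by
  choose c hc using fun α β : autKe A =>
    ((hW.implements α).mul (hW.implements β)).exists_eq_scalar_mul hA (hW.implements (α * β))
  exact ⟨c, hc⟩

end StoneVonNeumann

/-! ### Orbit sums and the commutant -/

section Orbits

variable {A : Type} [AddCommGroup A]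

theorem addOrderOf_prod_neg_left (k : K A) : addOrderOf ((-k.1, k.2) : K A) = addOrderOf k := by
  rw [Prod.addOrderOf_mk, addOrderOf_neg, Prod.addOrderOf]

variable [Fintype A] [DecidableEq A]

open Matrix

/-- The sum of the normalised Weyl operators over all `k` of additive order `d`. -/
def orderSum (A : Type) [AddCommGroup A] [Fintype A] [DecidableEq A] (d : ℕ) : Matrix A A ℂ :=
  ∑ k : K A, if addOrderOf k = d then weylMatrix k else 0

theorem orderSum_transpose (d : ℕ) : (orderSum A d).transpose = orderSum A d := by
  let ι : K A ≃ K A := (Equiv.neg A).prodCongr (Equiv.refl _)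
  rw [orderSum, transpose_sum, ← Equiv.sum_comp ι]
  refine Finset.sum_congr rfl fun k _ => ?_
  change (if addOrderOf ((-k.1, k.2) : K A) = d then weylMatrix (-k.1, k.2) else 0)ᵀ = _
  rw [addOrderOf_prod_neg_left]
  split_ifs
  · rw [weylMatrix_transpose, neg_neg]
  · exact transpose_zero

/-- The adjoint replaces `k` by `-k`, which has the same order. -/
theorem orderSum_isHermitian (d : ℕ) : (orderSum A d).IsHermitian := by
  rw [IsHermitian, orderSum, conjTranspose_sum, ← Equiv.sum_comp (Equiv.neg _)]
  refine Finset.sum_congr rfl fun k _ => ?_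
  rw [Equiv.neg_apply, addOrderOf_neg]
  split_ifs
  · rw [← weylMatrix_neg, neg_neg]
  · exact conjTranspose_zero

theorem Implements.commute_orderSum (hA : Odd (Fintype.card A)) {w : U A} {α : K A ≃ₗ[ℤ] K A}
    (h : Implements w α) (d : ℕ) : Commute (orderSum A d) (opMatrix w) := by
  rw [Commute, SemiconjBy, orderSum, Finset.sum_mul, Finset.mul_sum, ← Equiv.sum_comp α.toEquiv]
  refine Finset.sum_congr rfl fun k _ => ?_
  change (if addOrderOf (α k) = d then weylMatrix (α k) else 0) * _ = _
  rw [show addOrderOf (α k) = addOrderOf k from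
    addOrderOf_injective α.toAddEquiv.toAddMonoidHom α.injective k]
  split_ifs
  · rw [h.opMatrix_mul_weylMatrix hA]
  · simp

theorem sum_smul_orderSum {m : ℕ} (o : Fin m → ℕ) (a : Fin m → ℂ) :
    ∑ i, a i • orderSum A (o i) =
      ∑ k : K A, (∑ i, if addOrderOf k = o i then a i else 0) • weylMatrix k := by
  simp only [orderSum, Finset.smul_sum, Finset.sum_smul]
  rw [Finset.sum_comm]
  refine Finset.sum_congr rfl fun k _ => Finset.sum_congr rfl fun i _ => ?_
  split_ifs <;> simp

/-- If the elements of `K` have exactly `m` different additive orders, and `Aut(K, e)` is transitive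
on the elements of each order, then every Weil representation has a multiplicity-free decomposition
into `m` irreducible subrepresentations. -/
theorem IsWeilRepresentation.hasMultiplicityFreeDecomposition (hA : Odd (Fintype.card A))
    {W : autKe A → U A} (hW : IsWeilRepresentation W) {m : ℕ} (o : Fin m → ℕ)
    (ho : Function.Injective o) (ho' : ∀ k : K A, ∃ i, addOrderOf k = o i)
    (hne : ∀ i, ∃ k : K A, addOrderOf k = o i)
    (htrans : ∀ k l : K A, addOrderOf k = addOrderOf l → ∃ α ∈ autKe A, α k = l) :
    HasMultiplicityFreeDecomposition W m := by
  choose r hr using hne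
  have hsum : ∀ (a : Fin m → ℂ) (k : K A) i, addOrderOf k = o i →
      (∑ i', if addOrderOf k = o i' then a i' else 0) = a i := fun a k i hk => by
    rw [Finset.sum_eq_single i]
    · rw [if_pos hk]
    · intro j _ hj
      rw [if_neg]
      exact fun h => hj (ho (h.symm.trans hk))
    · simp
  have hcommutant : ∀ X : Matrix A A ℂ, (∀ α, Commute X (opMatrix (W α))) →
      ∃ a : Fin m → ℂ, X = ∑ i, a i • orderSum A (o i) := fun X hX => by
    set c := (weylBasis hA).repr X
    have hXc : X = ∑ k, c k • weylMatrix k := by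
      conv_lhs => rw [← (weylBasis hA).sum_repr X]
      simp only [weylBasis_apply, c]
    -- Conjugation by `W α` fixes `X` and permutes the Weyl basis, so comparing coefficients makes
    -- `c` constant on orbits.
    have hinv : ∀ α : autKe A, ∀ k, c ((α : K A ≃ₗ[ℤ] K A) k) = c k := fun α k => by
      have h1 : (∑ k, c ((α : K A ≃ₗ[ℤ] K A) k) • weylMatrix ((α : K A ≃ₗ[ℤ] K A) k)) *
          opMatrix (W α) = (∑ k, c k • weylMatrix ((α : K A ≃ₗ[ℤ] K A) k)) * opMatrix (W α) := by
        rw [show ∑ k, c ((α : K A ≃ₗ[ℤ] K A) k) • weylMatrix ((α : K A ≃ₗ[ℤ] K A) k) = X from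
          (Equiv.sum_comp (α : K A ≃ₗ[ℤ] K A).toEquiv fun k => c k • weylMatrix k).trans hXc.symm,
          (hX α).eq]
        conv_lhs => rw [hXc]
        rw [Finset.mul_sum, Finset.sum_mul]
        refine Finset.sum_congr rfl fun k _ => ?_
        rw [mul_smul_comm, (hW.implements α).opMatrix_mul_weylMatrix hA, smul_mul_assoc]
      have h2 := congrArg (· * opMatrix (W α)⁻¹) h1
      simp only [mul_assoc, opMatrix_mul_inv, mul_one] at h2
      have hli : LinearIndependent ℂ fun k : K A => weylMatrix ((α : K A ≃ₗ[ℤ] K A) k) :=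
        (weylMatrix_linearIndependent hA).comp _ (α : K A ≃ₗ[ℤ] K A).injective
      rw [← sub_eq_zero, ← Finset.sum_sub_distrib] at h2
      simp only [← sub_smul] at h2
      exact sub_eq_zero.1 (Fintype.linearIndependent_iff.1 hli _ h2 k)
    refine ⟨fun i => c (r i), ?_⟩
    rw [sum_smul_orderSum, hXc]
    refine Finset.sum_congr rfl fun k _ => ?_
    obtain ⟨i, hi⟩ := ho' k
    rw [hsum _ k i hi]
    obtain ⟨α, hα, hαk⟩ := htrans k (r i) (hi.trans (hr i).symm)
    rw [← hinv ⟨α, hα⟩ k, ← hαk]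
  have hmem : ∀ i α, Commute (orderSum A (o i)) (opMatrix (W α)) := fun i α =>
    (hW.implements α).commute_orderSum hA (o i)
  -- Gelfand's trick: the product lies in the commutant, so it is a combination of symmetric
  -- matrices and equals its transpose, which is the product in the other order.
  have hcomm : ∀ i j, Commute (orderSum A (o i)) (orderSum A (o j)) := fun i j => by
    obtain ⟨a, ha⟩ := hcommutant _ fun α => (hmem i α).mul_left (hmem j α)
    have ht : (orderSum A (o i) * orderSum A (o j))ᵀ = orderSum A (o i) * orderSum A (o j) := by
      rw [ha, transpose_sum]
      simp only [transpose_smul, orderSum_transpose]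
    rw [transpose_mul, orderSum_transpose, orderSum_transpose] at ht
    exact ht.symm
  have hli : LinearIndependent ℂ fun i => orderSum A (o i) := by
    rw [Fintype.linearIndependent_iff]
    intro a ha i
    rw [sum_smul_orderSum] at ha
    have := Fintype.linearIndependent_iff.1 (weylMatrix_linearIndependent hA) _ ha (r i)
    rwa [hsum _ _ i (hr i)] at this
  have hop : ∀ α f, toEuclideanCLM (n := A) (𝕜 := ℂ) (opMatrix (W α)) f = W α f := fun α f => by
    rw [toEuclideanCLM_opMatrix]
    rfl
  refine hasMultiplicityFreeDecomposition_of_commutant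
    (fun i => toEuclideanLin (orderSum A (o i)))
    (fun i => isSymmetric_toEuclideanLin_iff.2 (orderSum_isHermitian _)) (fun i j => ?_)
    (hli.map' toEuclideanLin.toLinearMap (LinearEquiv.ker _)) (fun i α v => ?_) fun X hX => ?_
  · have h := congrArg (toEuclideanCLM (n := A) (𝕜 := ℂ)) (hcomm i j).eq
    rw [map_mul, map_mul] at h
    exact LinearMap.ext fun v => DFunLike.congr_fun h v
  · have h := congrArg (toEuclideanCLM (n := A) (𝕜 := ℂ)) (hmem i α).eq
    rw [map_mul, map_mul] at h
    have := DFunLike.congr_fun h v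
    rwa [_root_.mul_apply_eq_comp, _root_.mul_apply_eq_comp, hop,
      hop] at this
  · obtain ⟨Y, rfl⟩ := toEuclideanLin.surjective X
    obtain ⟨a, rfl⟩ := hcommutant Y fun α => by
      refine (toEuclideanCLM (n := A) (𝕜 := ℂ)).injective ?_
      change toEuclideanCLM (n := A) (𝕜 := ℂ) _ = toEuclideanCLM (n := A) (𝕜 := ℂ) _
      rw [map_mul, map_mul]
      ext1 v
      rw [_root_.mul_apply_eq_comp, _root_.mul_apply_eq_comp, hop, hop]
      exact hX α v
    rw [map_sum]
    refine Submodule.sum_mem _ fun i _ => ?_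
    rw [map_smul]
    exact Submodule.smul_mem _ _ (Submodule.subset_span ⟨i, rfl⟩)

end Orbits

/-! ### The symplectic form and transvections -/

section SymplecticForm

open Matrix

variable {l R : Type*} [Fintype l] [DecidableEq l] [CommRing R]

/-- The standard symplectic form, with matrix `J`. -/
def omega (v w : l ⊕ l → R) : R := v ⬝ᵥ J l R *ᵥ w

theorem omega_eq (v w : l ⊕ l → R) :
    omega v w = (v ∘ Sum.inr) ⬝ᵥ (w ∘ Sum.inl) - (w ∘ Sum.inr) ⬝ᵥ (v ∘ Sum.inl) := by
  rw [omega, J, fromBlocks_mulVec, dotProduct, Fintype.sum_sum_type]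
  simp [dotProduct, neg_mulVec, mul_comm, sub_eq_neg_add]

theorem omega_self (v : l ⊕ l → R) : omega v v = 0 := by
  rw [omega_eq, sub_self]

theorem omega_swap (v w : l ⊕ l → R) : omega v w = -omega w v := by
  rw [omega_eq, omega_eq, neg_sub]

theorem omega_add_left (v v' w : l ⊕ l → R) : omega (v + v') w = omega v w + omega v' w :=
  add_dotProduct _ _ _

theorem omega_add_right (v w w' : l ⊕ l → R) : omega v (w + w') = omega v w + omega v w' := by
  rw [omega, mulVec_add, dotProduct_add]; rfl

theorem omega_sub_right (v w w' : l ⊕ l → R) : omega v (w - w') = omega v w - omega v w' := by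
  rw [omega, mulVec_sub, dotProduct_sub]; rfl

theorem omega_smul_left (a : R) (v w : l ⊕ l → R) : omega (a • v) w = a * omega v w :=
  smul_dotProduct _ _ _

theorem omega_smul_right (a : R) (v w : l ⊕ l → R) : omega v (a • w) = a * omega v w := by
  rw [omega, mulVec_smul, dotProduct_smul]; rfl

/-- The symplectic transvection `v ↦ v + a ω(v, u) u`. -/
def transvection (a : R) (u : l ⊕ l → R) : (l ⊕ l → R) ≃+ (l ⊕ l → R) where
  toFun v := v + (a * omega v u) • u
  invFun v := v - (a * omega v u) • u
  left_inv v := by simp [omega_add_left, omega_smul_left, omega_self]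
  right_inv v := by
    simp only [sub_eq_add_neg, ← neg_smul, omega_add_left, omega_smul_left, omega_self, mul_zero,
      add_zero]
    rw [neg_smul, neg_add_cancel_right]
  map_add' v w := by
    rw [omega_add_left, mul_add, add_smul]
    abel

theorem omega_transvection (a : R) (u v w : l ⊕ l → R) :
    omega (transvection a u v) (transvection a u w) = omega v w := by
  change omega (v + (a * omega v u) • u) (w + (a * omega w u) • u) = _
  simp only [omega_add_left, omega_add_right, omega_smul_left, omega_smul_right, omega_self]
  rw [omega_swap u w]
  ring

/-- Since `ω(v, v - w) = -ω(v, w)`, the choice `a = ω(v, w)⁻¹` subtracts exactly `v - w` from `v`.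
-/
theorem exists_transvection_eq {v w : l ⊕ l → R} (h : IsUnit (omega v w)) :
    ∃ a : R, transvection a (v - w) v = w := by
  obtain ⟨b, hb⟩ := h.exists_left_inv
  refine ⟨b, ?_⟩
  change v + (b * omega v (v - w)) • (v - w) = w
  rw [omega_sub_right, omega_self, zero_sub, mul_neg, hb, neg_one_smul]
  abel

theorem exists_isUnit_omega {v : l ⊕ l → R} (hv : ∃ i, IsUnit (v i)) :
    ∃ u, IsUnit (omega v u) := by
  obtain ⟨i | i, hi⟩ := hv
  · refine ⟨Pi.single (Sum.inr i) 1, ?_⟩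
    have : omega v (Pi.single (Sum.inr i) 1) = -v (Sum.inl i) := by
      rw [omega_eq]
      simp [dotProduct, Pi.single_apply]
    rw [this]
    exact hi.neg
  · refine ⟨Pi.single (Sum.inl i) 1, ?_⟩
    have : omega v (Pi.single (Sum.inl i) 1) = v (Sum.inr i) := by
      rw [omega_eq]
      simp [dotProduct, Pi.single_apply]
    rwa [this]

/-- Over a local ring, the symplectic group is transitive on the vectors that have a unit
coordinate. -/
theorem exists_symplectic_eq [IsLocalRing R] {v w : l ⊕ l → R} (hv : ∃ i, IsUnit (v i))
    (hw : ∃ i, IsUnit (w i)) :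
    ∃ f : (l ⊕ l → R) ≃+ (l ⊕ l → R), (∀ x y, omega (f x) (f y) = omega x y) ∧ f v = w := by
  -- Two transvections lead from `v` through `u` to `w` once `u` pairs to a unit with both. If
  -- neither `u₁` nor `u₂` does, their sum does, because unit plus non-unit is a unit in a local
  -- ring.
  obtain ⟨u, hu, hu'⟩ : ∃ u, IsUnit (omega v u) ∧ IsUnit (omega w u) := by
    obtain ⟨u₁, h₁⟩ := exists_isUnit_omega hv
    obtain ⟨u₂, h₂⟩ := exists_isUnit_omega hw
    by_cases h₁' : IsUnit (omega w u₁)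
    · exact ⟨u₁, h₁, h₁'⟩
    by_cases h₂' : IsUnit (omega v u₂)
    · exact ⟨u₂, h₂', h₂⟩
    have key : ∀ x y : R, IsUnit x → ¬ IsUnit y → IsUnit (x + y) := fun x y hx hy => by
      by_contra h
      have := (IsLocalRing.maximalIdeal R).sub_mem ((IsLocalRing.mem_maximalIdeal _).2 h)
        ((IsLocalRing.mem_maximalIdeal y).2 hy)
      rw [add_sub_cancel_right] at this
      exact (IsLocalRing.mem_maximalIdeal x).1 this hx
    refine ⟨u₁ + u₂, ?_, ?_⟩
    · rw [omega_add_right]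
      exact key _ _ h₁ h₂'
    · rw [omega_add_right, add_comm]
      exact key _ _ h₂ h₁'
  obtain ⟨a, ha⟩ := exists_transvection_eq hu
  obtain ⟨b, hb⟩ := exists_transvection_eq (v := u) (w := w) (by
    rw [omega_swap]; exact hu'.neg)
  refine ⟨(transvection a (v - u)).trans (transvection b (u - w)), fun x y => ?_, ?_⟩
  · rw [AddEquiv.trans_apply, AddEquiv.trans_apply, omega_transvection, omega_transvection]
  · rw [AddEquiv.trans_apply, ha, hb]

theorem mem_symplecticGroup_iff_omega {M : Matrix (l ⊕ l) (l ⊕ l) R} :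
    M ∈ symplecticGroup l R ↔ ∀ v w, omega (M *ᵥ v) (M *ᵥ w) = omega v w := by
  have h : ∀ v w, omega (M *ᵥ v) (M *ᵥ w) = v ⬝ᵥ (Mᵀ * J l R * M) *ᵥ w := fun v w => by
    rw [omega, ← mulVec_mulVec, ← mulVec_mulVec, dotProduct_mulVec v, vecMul_transpose]
  rw [SymplecticGroup.mem_iff']
  simp only [h]
  refine ⟨fun hM v w => by rw [hM]; rfl, fun hM => ?_⟩
  ext i j
  simpa [omega] using hM (Pi.single i 1) (Pi.single j 1)

end SymplecticForm

/-! ### Coordinates on K and the symplectic group -/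

section Coordinates

open Matrix

variable {N g : ℕ} [NeZero N]

theorem dotChar_apply (y u : Fin g → ZMod N) : dotChar y u = ZMod.toCircle (y ⬝ᵥ u) := rfl

theorem dotChar_add (y z : Fin g → ZMod N) : dotChar (y + z) = dotChar y + dotChar z := by
  ext1 u
  rw [dotChar_apply, add_dotProduct, AddChar.map_add_eq_mul]
  rfl

theorem dotChar_injective : Function.Injective (dotChar : (Fin g → ZMod N) → _) := by
  intro y z h
  ext1 i
  have := DFunLike.congr_fun h (Pi.single i 1)
  simpa [dotChar_apply, ZMod.injective_toCircle.eq_iff] using this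

theorem dotChar_bijective : Function.Bijective (dotChar : (Fin g → ZMod N) → _) := by
  rw [Fintype.bijective_iff_injective_and_card]
  exact ⟨dotChar_injective, by rw [← Nat.card_eq_fintype_card (α := Dual _), card_dual]⟩

/-- The identification of `(ℤ/N)^{2g}` with `K`. -/
def kEquiv : (Fin g ⊕ Fin g → ZMod N) ≃+ K (Fin g → ZMod N) where
  toEquiv := (Equiv.sumArrowEquivProdArrow _ _ _).trans
    ((Equiv.refl _).prodCongr (Equiv.ofBijective _ dotChar_bijective))
  map_add' _ _ := Prod.ext rfl (dotChar_add _ _)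

/-- As `ZMod.toCircle` is injective, preserving `e` amounts to preserving `omega`. -/
theorem e_kEquiv (v w : Fin g ⊕ Fin g → ZMod N) :
    e (kEquiv v) (kEquiv w) = ZMod.toCircle (omega v w) := by
  rw [omega_eq, AddChar.map_sub_eq_div, div_eq_mul_inv]
  rfl

/-- Transport of an additive automorphism from `(ℤ/N)^{2g}` to `K`. -/
def conjKEquiv (f : (Fin g ⊕ Fin g → ZMod N) ≃+ (Fin g ⊕ Fin g → ZMod N)) :
    K (Fin g → ZMod N) ≃ₗ[ℤ] K (Fin g → ZMod N) :=
  ((kEquiv.symm.trans f).trans kEquiv).toIntLinearEquiv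

theorem conjKEquiv_kEquiv (f : (Fin g ⊕ Fin g → ZMod N) ≃+ (Fin g ⊕ Fin g → ZMod N))
    (v : Fin g ⊕ Fin g → ZMod N) : conjKEquiv f (kEquiv v) = kEquiv (f v) := by
  change kEquiv (f (kEquiv.symm (kEquiv v))) = _
  rw [AddEquiv.symm_apply_apply]

theorem conjKEquiv_mem {f : (Fin g ⊕ Fin g → ZMod N) ≃+ (Fin g ⊕ Fin g → ZMod N)}
    (hf : ∀ v w, omega (f v) (f w) = omega v w) : conjKEquiv f ∈ autKe (Fin g → ZMod N) := by
  intro k l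
  obtain ⟨v, rfl⟩ := kEquiv.surjective k
  obtain ⟨w, rfl⟩ := kEquiv.surjective l
  rw [conjKEquiv_kEquiv, conjKEquiv_kEquiv, e_kEquiv, e_kEquiv, hf]

/-- The action of a symplectic matrix on column vectors. -/
def mulVecEquiv (M : symplecticGroup (Fin g) (ZMod N)) :
    (Fin g ⊕ Fin g → ZMod N) ≃+ (Fin g ⊕ Fin g → ZMod N) where
  toFun v := M.1 *ᵥ v
  invFun v := (M⁻¹).1 *ᵥ v
  left_inv v := by
    beta_reduce
    rw [mulVec_mulVec, ← Submonoid.coe_mul, inv_mul_cancel]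
    exact one_mulVec v
  right_inv v := by
    beta_reduce
    rw [mulVec_mulVec, ← Submonoid.coe_mul, mul_inv_cancel]
    exact one_mulVec v
  map_add' := mulVec_add _

/-- The action of the symplectic group on `K`. -/
def symplecticAction : symplecticGroup (Fin g) (ZMod N) →* autKe (Fin g → ZMod N) where
  toFun M := ⟨conjKEquiv (mulVecEquiv M),
    conjKEquiv_mem (mem_symplecticGroup_iff_omega.1 M.2)⟩
  map_one' := by
    refine Subtype.ext (LinearEquiv.ext fun k => ?_)
    obtain ⟨v, rfl⟩ := kEquiv.surjective k
    exact (conjKEquiv_kEquiv _ _).trans (congrArg _ (one_mulVec v))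
  map_mul' M M' := by
    refine Subtype.ext (LinearEquiv.ext fun k => ?_)
    obtain ⟨v, rfl⟩ := kEquiv.surjective k
    change conjKEquiv _ _ = conjKEquiv _ (conjKEquiv _ _)
    rw [conjKEquiv_kEquiv, conjKEquiv_kEquiv, conjKEquiv_kEquiv]
    exact congrArg _ (mulVec_mulVec v M.1 M'.1).symm

theorem symplecticAction_kEquiv (M : symplecticGroup (Fin g) (ZMod N))
    (v : Fin g ⊕ Fin g → ZMod N) :
    (symplecticAction M : K (Fin g → ZMod N) ≃ₗ[ℤ] _) (kEquiv v) = kEquiv (M.1 *ᵥ v) :=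
  conjKEquiv_kEquiv _ _

/-- Surjectivity: an additive endomorphism of `(ℤ/N)^{2g}` is automatically `ℤ/N`-linear, hence
given by a matrix. -/
theorem symplecticAction_bijective :
    Function.Bijective (symplecticAction (N := N) (g := g)) := by
  refine ⟨fun M M' h => Subtype.ext ?_, fun α => ?_⟩
  · refine Matrix.ext_of_mulVec_single fun i => kEquiv.injective ?_
    rw [← symplecticAction_kEquiv, h, symplecticAction_kEquiv]
  · let f : (Fin g ⊕ Fin g → ZMod N) →+ (Fin g ⊕ Fin g → ZMod N) :=
      (kEquiv.symm.toAddMonoidHom.comp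
        (α : K (Fin g → ZMod N) ≃ₗ[ℤ] _).toAddEquiv.toAddMonoidHom).comp kEquiv.toAddMonoidHom
    have hf : ∀ v, kEquiv (f v) = (α : K (Fin g → ZMod N) ≃ₗ[ℤ] _) (kEquiv v) := fun v =>
      kEquiv.apply_symm_apply _
    have hM : ∀ v, LinearMap.toMatrix' (f.toZModLinearMap N) *ᵥ v = f v := fun v => by
      rw [LinearMap.toMatrix'_mulVec]; rfl
    refine ⟨⟨LinearMap.toMatrix' (f.toZModLinearMap N), mem_symplecticGroup_iff_omega.2
      fun v w => ?_⟩, Subtype.ext (LinearEquiv.ext fun k => ?_)⟩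
    · rw [hM, hM]
      refine ZMod.injective_toCircle ?_
      rw [← e_kEquiv, ← e_kEquiv, hf, hf]
      exact α.2 _ _
    · obtain ⟨v, rfl⟩ := kEquiv.surjective k
      rw [symplecticAction_kEquiv, ← hf]
      exact congrArg _ (hM v)

end Coordinates

/-! ### Orbits on vectors modulo a prime power -/

section PrimePower

variable {p n g : ℕ}

theorem pow_nsmul_eq_zero {ι : Type*} (v : ι → ZMod (p ^ n)) : p ^ n • v = 0 := by
  ext i
  rw [Pi.smul_apply, nsmul_eq_mul, CharP.cast_eq_zero, zero_mul, Pi.zero_apply]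

variable [Fact p.Prime]

/-- A nontrivial quotient of the local ring of `p`-adic integers is local; `0 < n` gives
nontriviality. -/
theorem isLocalRing_zmod_prime_pow (hn : 0 < n) : IsLocalRing (ZMod (p ^ n)) :=
  have : Fact (1 < p ^ n) := ⟨Nat.one_lt_pow hn.ne' (Fact.out : p.Prime).one_lt⟩
  IsLocalRing.of_surjective' (PadicInt.toZModPow n : ℤ_[p] →+* ZMod (p ^ n))
    (ZMod.ringHom_surjective _)

theorem exists_eq_mul_of_pow_mul_eq_zero {j : ℕ} (hj : j ≤ n) {x : ZMod (p ^ n)}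
    (hx : (p : ZMod (p ^ n)) ^ j * x = 0) : ∃ y, x = (p : ZMod (p ^ n)) ^ (n - j) * y := by
  have hp : 0 < p := (Fact.out : p.Prime).pos
  rw [← ZMod.natCast_zmod_val x, ← Nat.cast_pow, ← Nat.cast_mul, ZMod.natCast_eq_zero_iff] at hx
  have h : p ^ (n - j) ∣ x.val := by
    refine Nat.dvd_of_mul_dvd_mul_left (pow_pos hp j) ?_
    rwa [← pow_add, Nat.add_sub_cancel' hj]
  obtain ⟨y, hy⟩ := h
  exact ⟨y, by rw [← ZMod.natCast_zmod_val x, hy, Nat.cast_mul, Nat.cast_pow]⟩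

theorem exists_eq_mul_of_not_isUnit {x : ZMod (p ^ n)} (hx : ¬ IsUnit x) :
    ∃ y, x = (p : ZMod (p ^ n)) * y := by
  rw [← ZMod.natCast_zmod_val x, ZMod.isUnit_iff_coprime] at hx
  have h : p ∣ x.val := by
    by_contra h
    exact hx (((Nat.Prime.coprime_iff_not_dvd Fact.out).2 h).symm.pow_right n)
  obtain ⟨y, hy⟩ := h
  exact ⟨y, by rw [← ZMod.natCast_zmod_val x, hy, Nat.cast_mul]⟩

/-- A vector of order `p ^ j` is `p ^ (n - j)` times a vector that has a unit coordinate. -/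
theorem exists_eq_nsmul_isUnit {ι : Type*} [Nonempty ι] {j : ℕ} (hj : j ≤ n)
    {v : ι → ZMod (p ^ n)} (hv : addOrderOf v = p ^ j) :
    ∃ v', (∃ i, IsUnit (v' i)) ∧ v = p ^ (n - j) • v' := by
  rcases Nat.eq_zero_or_pos j with rfl | hj0
  · rw [pow_zero, AddMonoid.addOrderOf_eq_one_iff] at hv
    -- Here `v = 0`, and `p ^ n` kills every vector, so the all-ones vector serves.
    refine ⟨1, ⟨Classical.arbitrary ι, isUnit_one⟩, ?_⟩
    rw [Nat.sub_zero, pow_nsmul_eq_zero, hv]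
  · have h0 : p ^ j • v = 0 := hv ▸ addOrderOf_nsmul_eq_zero v
    choose v' hv' using fun i => exists_eq_mul_of_pow_mul_eq_zero hj (x := v i) (by
      have := congrFun h0 i
      rwa [Pi.smul_apply, nsmul_eq_mul, Nat.cast_pow] at this)
    refine ⟨v', ?_, funext fun i => by rw [hv', Pi.smul_apply, nsmul_eq_mul, Nat.cast_pow]⟩
    -- If every coordinate of `v'` were divisible by `p`, then `p ^ (j - 1)` would already kill `v`.
    by_contra! hu
    choose z hz using fun i => exists_eq_mul_of_not_isUnit (hu i)
    have h1 : p ^ (j - 1) • v = 0 := by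
      ext i
      rw [Pi.smul_apply, nsmul_eq_mul, hv', hz, Nat.cast_pow, ← mul_assoc, ← mul_assoc, ← pow_add,
        ← pow_succ, show j - 1 + (n - j) + 1 = n by omega, ← Nat.cast_pow, CharP.cast_eq_zero,
        zero_mul, Pi.zero_apply]
    have h2 := addOrderOf_dvd_of_nsmul_eq_zero h1
    rw [hv, Nat.pow_dvd_pow_iff_le_right (Fact.out : p.Prime).one_lt] at h2
    omega

/-- Both elements are the same multiple `p ^ (n - j)` of vectors with a unit coordinate, and a
symplectic map between those vectors carries one multiple to the other. -/
theorem exists_autKe_eq (hn : 0 < n) (hg : 0 < g) (k l : K (Fin g → ZMod (p ^ n)))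
    (h : addOrderOf k = addOrderOf l) : ∃ α ∈ autKe (Fin g → ZMod (p ^ n)), α k = l := by
  have := isLocalRing_zmod_prime_pow (p := p) hn
  have : Nonempty (Fin g ⊕ Fin g) := ⟨Sum.inl ⟨0, hg⟩⟩
  obtain ⟨v, rfl⟩ := kEquiv.surjective k
  obtain ⟨w, rfl⟩ := kEquiv.surjective l
  rw [AddEquiv.addOrderOf_eq, AddEquiv.addOrderOf_eq] at h
  obtain ⟨j, hj, hv⟩ := (Nat.dvd_prime_pow Fact.out).1
    (addOrderOf_dvd_of_nsmul_eq_zero (pow_nsmul_eq_zero v))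
  obtain ⟨v', hv', rfl⟩ := exists_eq_nsmul_isUnit hj hv
  obtain ⟨w', hw', rfl⟩ := exists_eq_nsmul_isUnit hj (h ▸ hv)
  obtain ⟨f, hf, hfv⟩ := exists_symplectic_eq hv' hw'
  exact ⟨conjKEquiv f, conjKEquiv_mem hf, by rw [conjKEquiv_kEquiv, map_nsmul, hfv]⟩

theorem exists_addOrderOf_eq (k : K (Fin g → ZMod (p ^ n))) :
    ∃ i : Fin (n + 1), addOrderOf k = p ^ (i : ℕ) := by
  obtain ⟨v, rfl⟩ := kEquiv.surjective k
  obtain ⟨j, hj, hv⟩ := (Nat.dvd_prime_pow Fact.out).1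
    (addOrderOf_dvd_of_nsmul_eq_zero (pow_nsmul_eq_zero v))
  exact ⟨⟨j, Nat.lt_succ_of_le hj⟩, by rw [AddEquiv.addOrderOf_eq, hv]⟩

theorem exists_addOrderOf_eq_pow (hg : 0 < g) (i : Fin (n + 1)) :
    ∃ k : K (Fin g → ZMod (p ^ n)), addOrderOf k = p ^ (i : ℕ) := by
  have hp : 0 < p := (Fact.out : p.Prime).pos
  have hi : (i : ℕ) ≤ n := Nat.le_of_lt_succ i.2
  let s := AddMonoidHom.single (fun _ : Fin g ⊕ Fin g => ZMod (p ^ n)) (Sum.inl ⟨0, hg⟩)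
  have hs : addOrderOf (s 1) = p ^ n := by
    rw [addOrderOf_injective s fun a b h => by simpa [s] using congrFun h (Sum.inl ⟨0, hg⟩),
      ZMod.addOrderOf_one]
  refine ⟨kEquiv (p ^ (n - i) • s 1), ?_⟩
  rw [AddEquiv.addOrderOf_eq, addOrderOf_nsmul_of_dvd (pow_pos hp _).ne', hs,
    Nat.pow_div (Nat.sub_le _ _) hp, Nat.sub_sub_self hi]
  rw [hs]
  exact pow_dvd_pow _ (Nat.sub_le _ _)

end PrimePower

end Heisenberg

end

theorem mainTheorem10 (p n g : ℕ) [Fact p.Prime] (hp : p ≠ 2) (hn : 0 < n) (hg : 0 < g) :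
    (∃ Φ : Heisenberg.autKe (Fin g → ZMod (p ^ n)) ≃*
        Matrix.symplecticGroup (Fin g) (ZMod (p ^ n)),
      ∀ (α : Heisenberg.autKe (Fin g → ZMod (p ^ n))) (x y x' y' : Fin g → ZMod (p ^ n)),
        (α : Heisenberg.K (Fin g → ZMod (p ^ n)) ≃ₗ[ℤ] Heisenberg.K (Fin g → ZMod (p ^ n)))
            (x, Heisenberg.dotChar y) =
            (x', Heisenberg.dotChar y') ↔
          Matrix.mulVec (Φ α : Matrix (Fin g ⊕ Fin g) (Fin g ⊕ Fin g) (ZMod (p ^ n)))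
            (Sum.elim x y) = Sum.elim x' y') ∧
    (∃ W : Heisenberg.autKe (Fin g → ZMod (p ^ n)) → Heisenberg.U (Fin g → ZMod (p ^ n)),
      Heisenberg.IsWeilRepresentation W) ∧
    ∀ W : Heisenberg.autKe (Fin g → ZMod (p ^ n)) → Heisenberg.U (Fin g → ZMod (p ^ n)),
      Heisenberg.IsWeilRepresentation W →
        Heisenberg.IsProjectiveRepresentation W ∧
        Heisenberg.HasMultiplicityFreeDecomposition W (n + 1) := by
  have hA : Odd (Fintype.card (Fin g → ZMod (p ^ n))) := by
    rw [Fintype.card_fun, ZMod.card]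
    exact (((Fact.out : p.Prime).odd_of_ne_two hp).pow).pow
  refine ⟨⟨(MulEquiv.ofBijective _ Heisenberg.symplecticAction_bijective).symm,
    fun α x y x' y' => ?_⟩, ?_, fun W hW => ⟨hW.isProjectiveRepresentation hA, ?_⟩⟩
  · obtain ⟨M, rfl⟩ :=
      (MulEquiv.ofBijective _ Heisenberg.symplecticAction_bijective).surjective α
    rw [MulEquiv.symm_apply_apply, MulEquiv.ofBijective_apply]
    exact (Heisenberg.symplecticAction_kEquiv M (Sum.elim x y)).congr_left.trans
      ((Heisenberg.kEquiv (N := p ^ n)).injective.eq_iff (b := Sum.elim x' y'))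
  · choose W hW using fun α : Heisenberg.autKe (Fin g → ZMod (p ^ n)) =>
      Heisenberg.exists_implements hA α.2
    exact ⟨W, Heisenberg.isWeilRepresentation_of_implements hW⟩
  · exact hW.hasMultiplicityFreeDecomposition hA (fun i => p ^ (i : ℕ))
      (fun i j h => Fin.ext (Nat.pow_right_injective (Fact.out : p.Prime).two_le h))
      Heisenberg.exists_addOrderOf_eq (Heisenberg.exists_addOrderOf_eq_pow hg)
      (Heisenberg.exists_autKe_eq hn hg)
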